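/- Let $N\ge 1$ be an integer and let $q,a\in\mathbb{C}$ satisfy $0<|q|<1$ and $|a|<1$. Fix square roots $q^{1/2}$ and $a^{1/2}$ and read $q^{m/2}=(q^{1/2})^m$, $a^{m/2}=(a^{1/2})^m$ for integers $m$. Let $t_1,\dots,t_N\in\mathbb{C}$ satisfy $\prod_{i=1}^N t_i=1$, $|q\,t_i^2|<|a|$ for all $i$, and $t_i/t_j\notin q^{\mathbb{Z}}$ for all $i\neq j$. Write $(z;q)_\infty=\prod_{m\ge0}(1-zq^m)$, $(z;q)_m=\prod_{l=0}^{m-1}(1-zq^l)$, $(z_1,\dots,z_r;q)_m=\prod_s (z_s;q)_m$ (also for $m=\infty$), $(cz^{\pm1};q)_\infty=(cz,cz^{-1};q)_\infty$, and $${}_{r+1}\phi_r\!\left[\begin{matrix}A_1,\dots,A_{r+1}\\ B_1,\dots,B_r\end{matrix};q,z\right]=\sum_{m=0}^\infty\frac{(A_1,\dots,A_{r+1};q)_m}{(q,B_1,\dots,B_r;q)_m}z^m .$$ Let $\mathbb{T}$ be the positively oriented unit circle. The electric index of the $U(1)$ theory with $N$ flavours (with equal chemical potentials $s_i=t_i$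 for the two flavour groups and $w=1$) is $$I_{e,N}=\sum_{k\in\mathbb{Z}}a^{N|k|/2}\int_{\mathbb{T}}\prod_{i=1}^{N}\frac{(a^{1/2}q^{1/2+|k|/2}t_i^{-1}z^{\pm1};q)_\infty}{(a^{-1/2}q^{1/2+|k|/2}t_iz^{\pm1};q)_\infty}\,\frac{dz}{2\pi \mathrm{i} z}.$$ Then the integrals exist, the sum over $k$ and the series below converge absolutely, and $$I_{e,N}=\sum_{j=1}^{N}\frac{(a/t_j^2;q)_\infty}{(qt_j^2/a;q)_\infty}\prod_{i\neq j}\frac{(a/(t_jt_i),\,qt_j/t_i;q)_\infty}{(t_i/t_j,\,qt_jt_i/a;q)_\infty}\left({}_{N}\phi_{N-1}\!\left[\begin{matrix}(q t_jt_i/a)_{1\le i\le N}\\ (q t_j/t_i)_{1\le i\le N,\ i\neq j}\end{matrix};q,a^{N/2}\right]\right)^{2}.$$ -/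

import Mathlib

open scoped BigOperators

/-- The finite `q`-shifted factorial `(z;q)_n = ∏_{j=0}^{n-1} (1 - z q^j)`. -/
noncomputable def qPoch (z q : ℂ) (n : ℕ) : ℂ :=
  ∏ j ∈ Finset.range n, (1 - z * q ^ j)

/-- The infinite `q`-product `(z;q)_∞ = ∏_{j ≥ 0} (1 - z q^j)`, for `|q| < 1`. -/
noncomputable def qPochInf (z q : ℂ) : ℂ :=
  ∏' j : ℕ, (1 - z * q ^ j)

/-- The `m`-th term of the basic hypergeometric series
`_{r+1}φ_r[A_0, …, A_r; B_0, …, B_{r-1}; q, z]`. -/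
noncomputable def basicHypTerm {r : ℕ} (A : Fin (r + 1) → ℂ) (B : Fin r → ℂ) (q z : ℂ)
    (m : ℕ) : ℂ :=
  (∏ i, qPoch (A i) q m) / (qPoch q q m * ∏ i, qPoch (B i) q m) * z ^ m

/-- The basic hypergeometric series `_{r+1}φ_r`. -/
noncomputable def basicHyp {r : ℕ} (A : Fin (r + 1) → ℂ) (B : Fin r → ℂ) (q z : ℂ) : ℂ :=
  ∑' m : ℕ, basicHypTerm A B q z m

/-- The integrand (without the measure `dz / (2 π i z)`) of the electric index of the `U(1)` theory
with flavour fugacities `t`, in the sector of flux `k`. Here `x` stands for `q^{1/2}` and `b` for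
`a^{1/2}`, so that `q = x ^ 2`; the factor for each flavour `i` is
`(b x^{1+|k|} t_i⁻¹ z^{±1}; q)_∞ / (b⁻¹ x^{1+|k|} t_i z^{±1}; q)_∞`. -/
noncomputable def electricIntegrand {N : ℕ} (x b : ℂ) (t : Fin N → ℂ) (k : ℤ) (z : ℂ) : ℂ :=
  ∏ i, (qPochInf (b * x ^ (1 + k.natAbs) * (t i)⁻¹ * z) (x ^ 2) *
        qPochInf (b * x ^ (1 + k.natAbs) * (t i)⁻¹ * z⁻¹) (x ^ 2)) /
       (qPochInf (b⁻¹ * x ^ (1 + k.natAbs) * t i * z) (x ^ 2) *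
        qPochInf (b⁻¹ * x ^ (1 + k.natAbs) * t i * z⁻¹) (x ^ 2))

/-- The contribution of flux `k` to the electric index:
`a^{N|k|/2} ∮_{|z|=1} (integrand) dz / (2 π i z)`, with `b = a^{1/2}`. -/
noncomputable def electricTerm {N : ℕ} (x b : ℂ) (t : Fin N → ℂ) (k : ℤ) : ℂ :=
  b ^ (N * k.natAbs) *
    ((2 * Real.pi * Complex.I)⁻¹ * ∮ z in C(0, 1), electricIntegrand x b t k z / z)

/-- The electric index `I_{e,N;h}`, as the sum over all fluxes `k ∈ ℤ`. -/
noncomputable def electricIndex {N : ℕ} (x b : ℂ) (t : Fin N → ℂ) : ℂ :=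
  ∑' k : ℤ, electricTerm x b t k

/-- The numerator parameters `q t_j t_i / a`, for all `i`, of the series attached to `j`. -/
noncomputable def numParam {n : ℕ} (q a : ℂ) (t : Fin (n + 1) → ℂ) (j : Fin (n + 1)) :
    Fin (n + 1) → ℂ :=
  fun i => q * t j * t i / a

/-- The denominator parameters `q t_j / t_i`, for `i ≠ j` (as `i` runs over `Fin n`,
`j.succAbove i` runs over the indices different from `j`). -/
noncomputable def denParam {n : ℕ} (q : ℂ) (t : Fin (n + 1) → ℂ) (j : Fin (n + 1)) :
    Fin n → ℂ :=
  fun i => q * t j / t (j.succAbove i)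

/-- The prefactor
`(a/t_j²;q)_∞ / (q t_j²/a;q)_∞ ∏_{i≠j} (a/(t_j t_i), q t_j/t_i;q)_∞ / (t_i/t_j, q t_j t_i/a;q)_∞`. -/
noncomputable def prodPrefactor {n : ℕ} (q a : ℂ) (t : Fin (n + 1) → ℂ) (j : Fin (n + 1)) : ℂ :=
  qPochInf (a / t j ^ 2) q / qPochInf (q * t j ^ 2 / a) q *
    ∏ i : Fin n,
      (qPochInf (a / (t j * t (j.succAbove i))) q * qPochInf (q * t j / t (j.succAbove i)) q) /
      (qPochInf (t (j.succAbove i) / t j) q * qPochInf (q * t j * t (j.succAbove i) / a) q)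

open Filter Topology

/-! In the sector of flux `k` the integrand is `∏ᵢ (Aᵢz, Aᵢ/z; q)_∞ / (Bᵢz, Bᵢ/z; q)_∞` with `Aᵢ = b
x^(1+|k|)/tᵢ`, `Bᵢ = b⁻¹ x^(1+|k|) tᵢ` and `|Bᵢ| < 1`. In the punctured unit disc its only poles are
`Bⱼ qᵐ`, simple by genericity of `t`. On the circles `|z| = |q|^M r` the integrand is `O(|∏
Aᵢ/Bᵢ|^M)`, and `∏ Aᵢ/Bᵢ = a^N` because `∏ tᵢ = 1`. Contracting the contour to the origin therefore
gives the integral as the full sum of residues (`circleIntegral_qPochRatio_eq_tsum`).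

At `z = Bⱼ qᵐ` the arguments `Aᵢz`, `Bᵢz` depend on `k` and `m` only through `|k| + m`, while
`Aᵢ/z`, `Bᵢ/z` depend only on `m`. Hence the residue, weighted by `b^(N|k|)`, is a constant times
`φⱼ(|k|+m) φⱼ(m)`, with `φⱼ` the terms of the hypergeometric series (`pow_mul_qPochRatioResidue`).
Since `(k, m) ↦ (m + k⁺, m + k⁻)` is a bijection from `ℤ × ℕ` to `ℕ × ℕ`, summing over flux and
poles yields the square of the series (`hasSum_natAbs_add_mul`); the same double series gives
convergence of the flux sum. -/

/-! ### Finite and infinite `q`-products: zeros, analyticity, bounds, reflection. -/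

theorem qPoch_add (z q : ℂ) (m n : ℕ) :
    qPoch z q (m + n) = qPoch z q m * qPoch (z * q ^ m) q n := by
  simp only [qPoch, Finset.prod_range_add, pow_add, mul_assoc]

theorem qPoch_ne_zero_iff {z q : ℂ} {n : ℕ} :
    qPoch z q n ≠ 0 ↔ ∀ j < n, z * q ^ j ≠ 1 := by
  simp only [qPoch, Finset.prod_ne_zero_iff, sub_ne_zero, Finset.mem_range, @ne_comm ℂ 1]

theorem summable_norm_mul_pow (z : ℂ) {q : ℂ} (hq : ‖q‖ < 1) :
    Summable fun j : ℕ => ‖-(z * q ^ j)‖ := by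
  simpa using (summable_geometric_of_lt_one (norm_nonneg q) hq).mul_left ‖z‖

theorem multipliable_one_sub_mul_pow (z : ℂ) {q : ℂ} (hq : ‖q‖ < 1) :
    Multipliable fun j : ℕ => 1 - z * q ^ j := by
  simpa [sub_eq_add_neg] using multipliable_one_add_of_summable (summable_norm_mul_pow z hq)

theorem tendsto_qPoch (z : ℂ) {q : ℂ} (hq : ‖q‖ < 1) :
    Tendsto (qPoch z q) atTop (𝓝 (qPochInf z q)) :=
  (multipliable_one_sub_mul_pow z hq).hasProd.tendsto_prod_nat

theorem qPochInf_eq_qPoch_mul (z : ℂ) {q : ℂ} (hq : ‖q‖ < 1) (n : ℕ) :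
    qPochInf z q = qPoch z q n * qPochInf (z * q ^ n) q := by
  refine tendsto_nhds_unique ((tendsto_add_atTop_iff_nat n).2 (tendsto_qPoch z hq)) ?_
  simp_rw [add_comm _ n, qPoch_add]
  exact (tendsto_qPoch _ hq).const_mul _

theorem qPochInf_ne_zero {z q : ℂ} (hq : ‖q‖ < 1) (h : ∀ j : ℕ, z * q ^ j ≠ 1) :
    qPochInf z q ≠ 0 := by
  have := tprod_one_add_ne_zero_of_summable (f := fun j : ℕ => -(z * q ^ j))
    (fun j => by rw [← sub_eq_add_neg, sub_ne_zero]; exact (h j).symm) (summable_norm_mul_pow z hq)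
  simpa [qPochInf, sub_eq_add_neg] using this

theorem mul_pow_ne_one_of_norm_lt_one {z q : ℂ} (hq : ‖q‖ < 1) (hz : ‖z‖ < 1) (j : ℕ) :
    z * q ^ j ≠ 1 := by
  intro h
  have h1 : ‖z * q ^ j‖ < 1 := by
    rw [norm_mul, norm_pow]
    exact mul_lt_one_of_nonneg_of_lt_one_left (norm_nonneg _) hz (pow_le_one₀ (norm_nonneg _) hq.le)
  simp [h] at h1

theorem qPochInf_ne_zero_of_norm_lt_one {z q : ℂ} (hq : ‖q‖ < 1) (hz : ‖z‖ < 1) :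
    qPochInf z q ≠ 0 :=
  qPochInf_ne_zero hq (mul_pow_ne_one_of_norm_lt_one hq hz)

theorem differentiable_qPochInf {q : ℂ} (hq : ‖q‖ < 1) :
    Differentiable ℂ fun z => qPochInf z q := by
  intro z
  set U := Metric.ball (0 : ℂ) (‖z‖ + 1)
  have hsum : Summable fun j : ℕ => (‖z‖ + 1) * ‖q‖ ^ j :=
    (summable_geometric_of_lt_one (norm_nonneg q) hq).mul_left _
  have h := Summable.hasProdLocallyUniformlyOn_nat_one_add (R := ℂ)
    (f := fun (j : ℕ) (w : ℂ) => -(w * q ^ j)) (K := U) Metric.isOpen_ball hsum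
    (Eventually.of_forall fun j w hw => by
      have : ‖w‖ < ‖z‖ + 1 := by simpa [U] using hw
      rw [norm_neg, norm_mul, norm_pow]
      gcongr)
    (fun j => by fun_prop)
  have hd : DifferentiableOn ℂ (fun w => ∏' j : ℕ, (1 + -(w * q ^ j))) U := by
    refine h.tendstoLocallyUniformlyOn_finsetRange.differentiableOn ?_ Metric.isOpen_ball
    refine Eventually.of_forall fun n => ?_
    fun_prop
  have := hd.differentiableAt (Metric.isOpen_ball.mem_nhds (show z ∈ U by simp [U]))
  simpa [qPochInf, sub_eq_add_neg] using this

theorem norm_qPoch_le {z q : ℂ} (hq : ‖q‖ < 1) (n : ℕ) :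
    ‖qPoch z q n‖ ≤ Real.exp (‖z‖ * (1 - ‖q‖)⁻¹) := by
  have hsum := summable_geometric_of_lt_one (norm_nonneg q) hq
  calc ‖qPoch z q n‖ = ∏ j ∈ Finset.range n, ‖1 - z * q ^ j‖ := by simp [qPoch]
    _ ≤ ∏ j ∈ Finset.range n, Real.exp (‖z‖ * ‖q‖ ^ j) := by
        refine Finset.prod_le_prod (fun _ _ => norm_nonneg _) fun j _ => ?_
        calc ‖1 - z * q ^ j‖ ≤ ‖(1 : ℂ)‖ + ‖z * q ^ j‖ := norm_sub_le _ _
          _ = ‖z‖ * ‖q‖ ^ j + 1 := by simp [add_comm]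
          _ ≤ _ := Real.add_one_le_exp _
    _ = Real.exp (‖z‖ * ∑ j ∈ Finset.range n, ‖q‖ ^ j) := by
        rw [← Real.exp_sum, Finset.mul_sum]
    _ ≤ _ := by
        rw [← tsum_geometric_of_lt_one (norm_nonneg q) hq]
        gcongr
        exact hsum.sum_le_tsum _ fun _ _ => by positivity

theorem norm_qPochInf_le {z q : ℂ} (hq : ‖q‖ < 1) :
    ‖qPochInf z q‖ ≤ Real.exp (‖z‖ * (1 - ‖q‖)⁻¹) :=
  le_of_tendsto (tendsto_qPoch z hq).norm (Eventually.of_forall fun n => norm_qPoch_le hq n)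

/-- If the circle of radius `s` avoids the zeros `q ^ (-j)`, the finite products are bounded away
from zero on it, uniformly in the number of factors. -/
theorem exists_forall_le_norm_qPoch {q : ℂ} (hq : ‖q‖ < 1) {s : ℝ} (hs : ∀ j : ℕ, s * ‖q‖ ^ j ≠ 1) :
    ∃ c > 0, ∀ z : ℂ, ‖z‖ = s → ∀ n, c ≤ ‖qPoch z q n‖ := by
  have hq' : ‖(‖q‖ : ℂ)‖ < 1 := by simpa using hq
  have hs' : ∀ j : ℕ, (s : ℂ) * (‖q‖ : ℂ) ^ j ≠ 1 := fun j => by exact_mod_cast hs j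
  have hne : ∀ n, qPoch s ‖q‖ n ≠ 0 := fun n => qPoch_ne_zero_iff.2 fun j _ => hs' j
  -- With base `‖q‖` and argument `s`, the inverse products converge and so are bounded. Factor by
  -- factor, `|1 - z qʲ| ≥ |1 - s ‖q‖ʲ|` carries the bound to the whole circle.
  have hlim := ((tendsto_qPoch (s : ℂ) hq').inv₀ (qPochInf_ne_zero hq' hs')).norm
  obtain ⟨C, hC⟩ := hlim.bddAbove_range
  have hC' : ∀ n, ‖(qPoch s ‖q‖ n)⁻¹‖ ≤ C := fun n => hC ⟨n, rfl⟩
  have hCpos : 0 < C := lt_of_lt_of_le (norm_pos_iff.2 (inv_ne_zero (hne 0))) (hC' 0)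
  refine ⟨C⁻¹, inv_pos.2 hCpos, fun z hz n => ?_⟩
  have h1 : C⁻¹ ≤ ‖qPoch s ‖q‖ n‖ := by
    have := hC' n
    rw [norm_inv] at this
    exact inv_le_of_inv_le₀ (norm_pos_iff.2 (hne n)) this
  refine h1.trans ?_
  simp only [qPoch, norm_prod]
  refine Finset.prod_le_prod (fun _ _ => norm_nonneg _) fun j _ => ?_
  have h2 : ‖(1 : ℂ) - (s : ℂ) * (‖q‖ : ℂ) ^ j‖ = |1 - s * ‖q‖ ^ j| := by
    rw [← Real.norm_eq_abs, ← Complex.norm_real]; push_cast; rfl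
  rw [h2, ← hz, ← norm_pow, ← norm_mul]
  simpa using abs_norm_sub_norm_le (1 : ℂ) (z * q ^ j)

theorem exists_forall_le_norm_qPochInf {q : ℂ} (hq : ‖q‖ < 1) {s : ℝ}
    (hs : ∀ j : ℕ, s * ‖q‖ ^ j ≠ 1) : ∃ c > 0, ∀ z : ℂ, ‖z‖ = s → c ≤ ‖qPochInf z q‖ := by
  obtain ⟨c, hc, h⟩ := exists_forall_le_norm_qPoch hq hs
  exact ⟨c, hc, fun z hz => ge_of_tendsto (tendsto_qPoch z hq).norm (Eventually.of_forall (h z hz))⟩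

/-- Reflection of a finite `q`-shifted factorial: `(y q⁻ᵐ; q)_m = yᵐ cₘ (q/y; q)_m`, where
`cₘ = ∏_{l<m} (-q^{-(l+1)})` does not depend on `y`. -/
theorem qPoch_div_pow {y q : ℂ} (hy : y ≠ 0) (hq : q ≠ 0) (m : ℕ) :
    qPoch (y / q ^ m) q m =
      y ^ m * (∏ l ∈ Finset.range m, -(q ^ (l + 1))⁻¹) * qPoch (q / y) q m := by
  have hc : y ^ m = ∏ _l ∈ Finset.range m, y := by simp
  rw [qPoch, ← Finset.prod_range_reflect, qPoch, hc, ← Finset.prod_mul_distrib,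
    ← Finset.prod_mul_distrib]
  refine Finset.prod_congr rfl fun l hl => ?_
  have hl' := Finset.mem_range.1 hl
  obtain ⟨d, rfl⟩ : ∃ d, m = d + (l + 1) := ⟨m - (l + 1), by omega⟩
  have : d + (l + 1) - 1 - l = d := by omega
  rw [this]
  field_simp
  ring

/-- `(y q⁻ᵐ; q)_∞` in terms of `(y; q)_∞`. -/
theorem qPochInf_div_pow {y q : ℂ} (hy : y ≠ 0) (hq : q ≠ 0) (hq1 : ‖q‖ < 1) (m : ℕ) :
    qPochInf (y / q ^ m) q =
      y ^ m * (∏ l ∈ Finset.range m, -(q ^ (l + 1))⁻¹) * qPoch (q / y) q m * qPochInf y q := by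
  rw [qPochInf_eq_qPoch_mul _ hq1 m, qPoch_div_pow hy hq, div_mul_cancel₀ _ (pow_ne_zero _ hq)]

/-! ### Residue theorem on an annulus, simple poles. -/

/-- If `p` lies in the annulus, split `g z / (z - p)` as `dslope g p z + g p / (z - p)`. The first
part is holomorphic across `p`, so both circles give it the same integral; the second gives `2πi g
p` outside and `0` inside. If `p` lies in the inner disc, nothing is singular between the circles.
-/
theorem circleIntegral_div_sub_eq_of_annulus {U : Set ℂ} (hU : IsOpen U) {r R : ℝ} (hr : 0 < r)
    (hrR : r ≤ R) (hsub : Metric.closedBall 0 R \ Metric.ball 0 r ⊆ U) {g : ℂ → ℂ}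
    (hg : DifferentiableOn ℂ g U) {p : ℂ} (hpR : ‖p‖ < R) (hpr : ‖p‖ ≠ r) :
    (∮ z in C(0, R), g z / (z - p)) =
      (∮ z in C(0, r), g z / (z - p)) + if r < ‖p‖ then 2 * Real.pi * Complex.I * g p else 0 := by
  have hR : 0 < R := hr.trans_le hrR
  split_ifs with h
  · have hpU : p ∈ U := hsub ⟨by simpa using hpR.le, by simpa using h.le⟩
    have hd : DifferentiableOn ℂ (dslope g p) U :=
      (Complex.differentiableOn_dslope (hU.mem_nhds hpU)).2 hg
    have hcirc : ∀ ρ, r ≤ ρ → ρ ≤ R → Metric.sphere (0 : ℂ) ρ ⊆ U := fun ρ h1 h2 z hz => hsub <| by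
      have : ‖z‖ = ρ := by simpa using hz
      simp [this, h1, h2]
    have key : ∀ ρ, 0 < ρ → r ≤ ρ → ρ ≤ R → ‖p‖ ≠ ρ → (∮ z in C(0, ρ), g z / (z - p)) =
        (∮ z in C(0, ρ), dslope g p z) + g p * ∮ z in C(0, ρ), (z - p)⁻¹ := by
      intro ρ h0 h1 h2 h3
      have hne : ∀ z ∈ Metric.sphere (0 : ℂ) ρ, z - p ≠ 0 := by
        rintro z hz h4
        rw [sub_eq_zero] at h4
        exact h3 (by simpa [h4] using hz)
      have hi1 : CircleIntegrable (dslope g p) 0 ρ :=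
        (hd.continuousOn.mono (hcirc ρ h1 h2)).circleIntegrable h0.le
      have hi2 : CircleIntegrable (fun z => (z - p)⁻¹) 0 ρ :=
        ContinuousOn.circleIntegrable h0.le
          ((continuousOn_id.sub continuousOn_const).inv₀ fun z hz => hne z hz)
      have hi3 : CircleIntegrable (fun z => g p * (z - p)⁻¹) 0 ρ := hi2.const_fun_smul (a := g p)
      rw [← circleIntegral.integral_const_mul, ← circleIntegral.integral_add hi1 hi3]
      refine circleIntegral.integral_congr h0.le fun z hz => ?_
      have hz' := hne z hz
      rw [dslope_of_ne _ (sub_ne_zero.1 hz'), slope_def_field]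
      field_simp
      ring
    rw [key R hR hrR le_rfl hpR.ne, key r hr le_rfl hrR h.ne',
      Complex.circleIntegral_eq_of_differentiable_on_annulus_off_countable hr hrR
        Set.countable_empty (hd.continuousOn.mono hsub) fun z hz => hd.differentiableAt
          (hU.mem_nhds (hsub ⟨Metric.ball_subset_closedBall hz.1.1,
            fun hz' => hz.1.2 (Metric.ball_subset_closedBall hz')⟩)),
      circleIntegral.integral_sub_inv_of_mem_ball (by simpa using hpR)]
    have : (∮ z in C(0, r), (z - p)⁻¹) = 0 := by
      refine Complex.circleIntegral_eq_zero_of_differentiable_on_off_countable hr.le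
        Set.countable_empty ?_ ?_
      · refine (continuousOn_id.sub continuousOn_const).inv₀ fun z hz h4 => ?_
        replace h4 : z = p := sub_eq_zero.1 h4
        have : ‖z‖ ≤ r := by simpa using hz
        rw [h4] at this
        linarith
      · intro z hz
        have : ‖z‖ < r := by simpa using hz.1
        refine (differentiableAt_id.sub_const p).inv fun h4 => ?_
        replace h4 : z = p := sub_eq_zero.1 h4
        rw [h4] at this
        linarith
    rw [this]
    ring
  · have hp : ‖p‖ < r := lt_of_le_of_ne (not_lt.1 h) hpr
    have hdU : ∀ z ∈ Metric.closedBall (0 : ℂ) R \ Metric.ball 0 r,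
        DifferentiableAt ℂ (fun z => g z / (z - p)) z := by
      intro z hz
      refine (hg.differentiableAt (hU.mem_nhds (hsub hz))).div
        (differentiableAt_id.sub_const p) fun h4 => ?_
      replace h4 : z = p := sub_eq_zero.1 h4
      exact hz.2 (by simpa [h4] using hp)
    rw [add_zero]
    exact Complex.circleIntegral_eq_of_differentiable_on_annulus_off_countable hr hrR
      Set.countable_empty (fun z hz => (hdU z hz).continuousAt.continuousWithinAt)
      fun z hz => hdU z ⟨Metric.ball_subset_closedBall hz.1.1,
            fun hz' => hz.1.2 (Metric.ball_subset_closedBall hz')⟩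

/-- Partial fractions, obtained by interpolating the constant `1` at the nodes and dividing by the
nodal polynomial. -/
theorem inv_prod_sub_eq_sum_nodalWeight {ι : Type*} [DecidableEq ι] {s : Finset ι}
    (hs : s.Nonempty) {v : ι → ℂ} (hv : Set.InjOn v s) {z : ℂ} (hz : ∀ i ∈ s, z ≠ v i) :
    (∏ i ∈ s, (z - v i))⁻¹ = ∑ i ∈ s, Lagrange.nodalWeight s v i * (z - v i)⁻¹ := by
  have h := congrArg (Polynomial.eval z) (Lagrange.sum_basis hv hs)
  rw [Polynomial.eval_finsetSum, Polynomial.eval_one, Finset.sum_congr rfl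
    fun i hi => Lagrange.eval_basis_not_at_node hi (hz i hi), ← Finset.mul_sum,
    Lagrange.eval_nodal] at h
  exact inv_eq_of_mul_eq_one_right h

/-- The residue theorem on an annulus for a function `F = G / ∏ (z - vᵢ)` with simple poles. -/
theorem circleIntegral_eq_add_sum_residues {ι : Type*} [DecidableEq ι] {U : Set ℂ} (hU : IsOpen U)
    {r R : ℝ} (hr : 0 < r) (hrR : r ≤ R) (hsub : Metric.closedBall 0 R \ Metric.ball 0 r ⊆ U)
    {F G : ℂ → ℂ} (hG : DifferentiableOn ℂ G U) {s : Finset ι} (hs : s.Nonempty) {v : ι → ℂ}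
    (hv : Set.InjOn v s) (hvR : ∀ i ∈ s, ‖v i‖ < R) (hvr : ∀ i ∈ s, ‖v i‖ ≠ r)
    (hF : ∀ z ∈ U, (∀ i ∈ s, z ≠ v i) → F z = G z / ∏ i ∈ s, (z - v i)) {c : ι → ℂ}
    (hc : ∀ i ∈ s, Tendsto (fun z => (z - v i) * F z) (𝓝[≠] v i) (𝓝 (c i))) :
    (∮ z in C(0, R), F z) =
      (∮ z in C(0, r), F z) + 2 * Real.pi * Complex.I * ∑ i ∈ s with r < ‖v i‖, c i := by
  have hR : 0 < R := hr.trans_le hrR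
  have key : ∀ ρ, 0 < ρ → r ≤ ρ → ρ ≤ R → (∀ i ∈ s, ‖v i‖ ≠ ρ) → (∮ z in C(0, ρ), F z) =
      ∑ i ∈ s, Lagrange.nodalWeight s v i * ∮ z in C(0, ρ), G z / (z - v i) := by
    intro ρ h0 h1 h2 h3
    have hcirc : Metric.sphere (0 : ℂ) ρ ⊆ U := fun z hz => hsub <| by
      have : ‖z‖ = ρ := by simpa using hz
      simp [this, h1, h2]
    have hne : ∀ i ∈ s, ∀ z ∈ Metric.sphere (0 : ℂ) ρ, z ≠ v i := by
      rintro i hi z hz rfl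
      exact h3 i hi (by simpa using hz)
    simp_rw [← circleIntegral.integral_const_mul]
    rw [← circleIntegral.integral_fun_sum]
    · refine circleIntegral.integral_congr h0.le fun z hz => ?_
      rw [hF z (hcirc hz) fun i hi => hne i hi z hz, div_eq_mul_inv,
        inv_prod_sub_eq_sum_nodalWeight hs hv fun i hi => hne i hi z hz, Finset.mul_sum]
      refine Finset.sum_congr rfl fun i _ => ?_
      ring
    · intro i hi
      refine ContinuousOn.circleIntegrable h0.le (continuousOn_const.mul
        ((hG.continuousOn.mono hcirc).div (continuousOn_id.sub continuousOn_const) fun z hz => ?_))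
      exact sub_ne_zero.2 (hne i hi z hz)
  -- Both sides are the limit of `(z - vᵢ) F z` at `vᵢ`, so the partial-fraction coefficient is the
  -- residue.
  have hcw : ∀ i ∈ s, r < ‖v i‖ → Lagrange.nodalWeight s v i * G (v i) = c i := by
    intro i hi hri
    have hvU : v i ∈ U := hsub ⟨by simpa using (hvR i hi).le, by simpa using hri.le⟩
    have hne : ∀ j ∈ s.erase i, v i ≠ v j := fun j hj h =>
      Finset.ne_of_mem_erase hj (hv (Finset.mem_of_mem_erase hj) hi h.symm)
    refine tendsto_nhds_unique (f := fun z => (z - v i) * F z) (l := 𝓝[≠] v i) ?_ (hc i hi)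
    have h1 : Tendsto (fun z => (∏ j ∈ s.erase i, (z - v j))⁻¹ * G z) (𝓝[≠] v i)
        (𝓝 (Lagrange.nodalWeight s v i * G (v i))) := by
      rw [Lagrange.nodalWeight, Finset.prod_inv_distrib]
      refine Tendsto.mono_left ?_ nhdsWithin_le_nhds
      refine ContinuousAt.mul (ContinuousAt.inv₀ (by fun_prop) ?_)
        (hG.differentiableAt (hU.mem_nhds hvU)).continuousAt
      exact Finset.prod_ne_zero_iff.2 fun j hj => sub_ne_zero.2 (hne j hj)
    refine h1.congr' ?_
    have h2 : ∀ᶠ z in 𝓝[≠] v i, ∀ j ∈ s.erase i, z ≠ v j :=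
      ((Finset.eventually_all _).2 fun j hj => eventually_ne_nhds (hne j hj)).filter_mono
        nhdsWithin_le_nhds
    filter_upwards [h2, nhdsWithin_le_nhds (hU.mem_nhds hvU), self_mem_nhdsWithin] with z h3 h4 h5
    have h5' : z - v i ≠ 0 := sub_ne_zero.2 h5
    rw [hF z h4 fun j hj => ?_, ← Finset.mul_prod_erase s _ hi]
    · field_simp
    · rcases eq_or_ne j i with rfl | hji
      · exact h5
      · exact h3 j (Finset.mem_erase.2 ⟨hji, hj⟩)
  rw [key R hR hrR le_rfl fun i hi => (hvR i hi).ne, key r hr le_rfl hrR hvr, Finset.sum_filter,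
    Finset.mul_sum, ← Finset.sum_add_distrib]
  refine Finset.sum_congr rfl fun i hi => ?_
  rw [circleIntegral_div_sub_eq_of_annulus hU hr hrR hsub hG (hvR i hi) (hvr i hi), mul_add]
  split_ifs with h
  · rw [← hcw i hi h]; ring
  · simp

/-! ### Decay, poles and residues of the `q`-product ratio. -/

theorem pow_injective_of_norm_lt_one {q : ℂ} (hq0 : q ≠ 0) (hq : ‖q‖ < 1) :
    Function.Injective fun m : ℕ => q ^ m := fun l m h =>
  pow_right_injective₀ (norm_pos_iff.2 hq0) hq.ne (by simpa using congrArg norm h)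

/-- The product `∏ᵢ (Aᵢ z, Aᵢ / z; q)_∞ / (Bᵢ z, Bᵢ / z; q)_∞`. -/
noncomputable def qPochRatio {N : ℕ} (A B : Fin N → ℂ) (q z : ℂ) : ℂ :=
  ∏ i, (qPochInf (A i * z) q * qPochInf (A i * z⁻¹) q) /
    (qPochInf (B i * z) q * qPochInf (B i * z⁻¹) q)

/-- The residue of `qPochRatio A B q z / z` at `z = Bⱼ qᵐ`. -/
noncomputable def qPochRatioResidue {n : ℕ} (A B : Fin (n + 1) → ℂ) (q : ℂ) (j : Fin (n + 1))
    (m : ℕ) : ℂ :=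
  (∏ i, qPochInf (A i * (B j * q ^ m)) q * qPochInf (A i * (B j * q ^ m)⁻¹) q /
      qPochInf (B i * (B j * q ^ m)) q) /
    ((∏ i, qPochInf (B (j.succAbove i) * (B j * q ^ m)⁻¹) q) *
      (qPoch (B j * (B j * q ^ m)⁻¹) q m * qPochInf (B j * (B j * q ^ m)⁻¹ * q ^ (m + 1)) q))

/-- Reflecting `(Aᵢ/z · q⁻ᴹ; q)_∞` and `(Bᵢ/z · q⁻ᴹ; q)_∞` produces the same constant, which
cancels, and the powers leave `(Aᵢ/Bᵢ)ᴹ`. Everything else stays bounded in `M` on a suitable circle.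
-/
theorem qPochRatio_pow_mul {N : ℕ} {A B : Fin N → ℂ} {q z : ℂ} (hq0 : q ≠ 0) (hq : ‖q‖ < 1)
    (hA : ∀ i, A i ≠ 0) (hB : ∀ i, B i ≠ 0) (hz : z ≠ 0) (hBz : ∀ i, ‖B i * z‖ < 1) (M : ℕ) :
    qPochRatio A B q (q ^ M * z) = (∏ i, A i / B i) ^ M *
      ∏ i, (qPochInf (A i * (q ^ M * z)) q * qPoch (q * z / A i) q M * qPochInf (A i / z) q *
        qPoch (B i * z) q M) /
        (qPochInf (B i * z) q * (qPoch (q * z / B i) q M * qPochInf (B i / z) q)) := by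
  rw [qPochRatio, ← Finset.prod_pow, ← Finset.prod_mul_distrib]
  refine Finset.prod_congr rfl fun i _ => ?_
  have e : ∀ c : ℂ, c * (q ^ M * z)⁻¹ = c / z / q ^ M := fun c => by field_simp
  have e2 : ∀ c : ℂ, c ≠ 0 → q / (c / z) = q * z / c := fun c hc => by field_simp
  have h1 := qPochInf_eq_qPoch_mul (B i * z) hq M
  have h2 : qPoch (B i * z) q M ≠ 0 :=
    qPoch_ne_zero_iff.2 fun j _ => mul_pow_ne_one_of_norm_lt_one hq (hBz i) j
  have h3 : qPochInf (B i * (q ^ M * z)) q = qPochInf (B i * z) q / qPoch (B i * z) q M := by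
    rw [h1, mul_div_cancel_left₀ _ h2, mul_assoc, mul_comm z]
  have h4 : (∏ l ∈ Finset.range M, -(q ^ (l + 1))⁻¹) ≠ 0 :=
    Finset.prod_ne_zero_iff.2 fun l _ => neg_ne_zero.2 (inv_ne_zero (pow_ne_zero _ hq0))
  rw [e, e, qPochInf_div_pow (div_ne_zero (hA i) hz) hq0 hq,
    qPochInf_div_pow (div_ne_zero (hB i) hz) hq0 hq, h3, e2 _ (hA i), e2 _ (hB i)]
  have h5 : (A i / B i) ^ M = (A i / z) ^ M / (B i / z) ^ M := by
    rw [← div_pow]; congr 1; have := hB i; field_simp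
  rw [h5]
  have h6 : (B i / z) ^ M ≠ 0 := pow_ne_zero _ (div_ne_zero (hB i) hz)
  set c := ∏ l ∈ Finset.range M, -(q ^ (l + 1))⁻¹
  generalize (B i / z) ^ M = u at *
  generalize (A i / z) ^ M = w at *
  rw [div_mul_div_comm, div_mul_eq_mul_div, div_div_eq_mul_div]
  refine Eq.trans ?_ (mul_div_mul_left _ _ h4)
  congr 1 <;> ring

theorem exists_forall_norm_qPochRatio_le {N : ℕ} {A B : Fin N → ℂ} {q : ℂ} (hq0 : q ≠ 0)
    (hq : ‖q‖ < 1) (hA : ∀ i, A i ≠ 0) (hB : ∀ i, B i ≠ 0) (hB1 : ∀ i, ‖B i‖ < 1) {r : ℝ}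
    (hr0 : 0 < r) (hr1 : r < 1) (hr : ∀ i, ∀ e : ℤ, ‖B i‖ * ‖q‖ ^ e ≠ r) :
    ∃ C, ∀ M : ℕ, ∀ z : ℂ, ‖z‖ = r →
      ‖qPochRatio A B q (q ^ M * z)‖ ≤ ‖∏ i, A i / B i‖ ^ M * C := by
  have hqp : 0 < ‖q‖ := norm_pos_iff.2 hq0
  have hBr : ∀ i, ‖B i‖ * r < 1 := fun i =>
    mul_lt_one_of_nonneg_of_lt_one_left (norm_nonneg _) (hB1 i) hr1.le
  have hex : ∀ i, ∃ C, ∀ M : ℕ, ∀ z : ℂ, ‖z‖ = r →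
      ‖(qPochInf (A i * (q ^ M * z)) q * qPoch (q * z / A i) q M * qPochInf (A i / z) q *
        qPoch (B i * z) q M) /
        (qPochInf (B i * z) q * (qPoch (q * z / B i) q M * qPochInf (B i / z) q))‖ ≤ C := by
    intro i
    have hBp : 0 < ‖B i‖ := norm_pos_iff.2 (hB i)
    obtain ⟨c₁, hc₁, h₁⟩ := exists_forall_le_norm_qPochInf hq (s := ‖B i‖ * r) fun j =>
      (mul_lt_one_of_nonneg_of_lt_one_left (by positivity) (hBr i)
        (pow_le_one₀ (norm_nonneg _) hq.le)).ne
    -- A zero here would mean `r = ‖Bᵢ‖ ‖q‖^(-(j+1))`: this is why `r` must avoid negative exponents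
    -- too.
    obtain ⟨c₂, hc₂, h₂⟩ := exists_forall_le_norm_qPoch hq (s := ‖q‖ * r / ‖B i‖) fun j h => by
      refine hr i (-(j + 1)) ?_
      rw [zpow_neg, ← Nat.cast_succ, zpow_natCast, pow_succ]
      field_simp at h ⊢
      linarith
    obtain ⟨c₃, hc₃, h₃⟩ := exists_forall_le_norm_qPochInf hq (s := ‖B i‖ / r) fun j h => by
      refine hr i j ?_
      rw [zpow_natCast]
      field_simp at h ⊢
      linarith
    set b : ℝ → ℝ := fun u => Real.exp (u * (1 - ‖q‖)⁻¹)
    have hb : ∀ u, 0 < b u := fun u => Real.exp_pos _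
    refine ⟨b (‖A i‖ * r) * b (‖q‖ * r / ‖A i‖) * b (‖A i‖ / r) * b (‖B i‖ * r) /
      (c₁ * (c₂ * c₃)), fun M z hz => ?_⟩
    rw [norm_div, norm_mul, norm_mul, norm_mul, norm_mul, norm_mul]
    have g1 : ‖qPochInf (A i * (q ^ M * z)) q‖ ≤ b (‖A i‖ * r) := by
      refine (norm_qPochInf_le hq).trans (Real.exp_le_exp.2 ?_)
      have : 0 ≤ (1 - ‖q‖)⁻¹ := inv_nonneg.2 (by linarith)
      refine mul_le_mul_of_nonneg_right ?_ this
      rw [norm_mul, norm_mul, norm_pow, hz]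
      refine mul_le_mul_of_nonneg_left ?_ (norm_nonneg _)
      exact mul_le_of_le_one_left hr0.le (pow_le_one₀ (norm_nonneg _) hq.le)
    have g2 : ‖qPoch (q * z / A i) q M‖ ≤ b (‖q‖ * r / ‖A i‖) := by
      simpa [b, hz] using norm_qPoch_le (z := q * z / A i) hq M
    have g3 : ‖qPochInf (A i / z) q‖ ≤ b (‖A i‖ / r) := by
      simpa [b, hz] using norm_qPochInf_le (z := A i / z) hq
    have g4 : ‖qPoch (B i * z) q M‖ ≤ b (‖B i‖ * r) := by
      simpa [b, hz] using norm_qPoch_le (z := B i * z) hq M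
    have g5 := h₁ (B i * z) (by simp [hz])
    have g6 := h₂ (q * z / B i) (by simp [hz]) M
    have g7 := h₃ (B i / z) (by simp [hz])
    have := hb (‖A i‖ * r)
    have := hb (‖q‖ * r / ‖A i‖)
    have := hb (‖A i‖ / r)
    gcongr
  choose C hC using hex
  refine ⟨∏ i, C i, fun M z hz => ?_⟩
  have hz0 : z ≠ 0 := norm_pos_iff.1 (by rw [hz]; exact hr0)
  rw [qPochRatio_pow_mul hq0 hq hA hB hz0 fun i => by rw [norm_mul, hz]; exact hBr i, norm_mul,
    norm_pow]
  refine mul_le_mul_of_nonneg_left ?_ (by positivity)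
  rw [norm_prod]
  exact Finset.prod_le_prod (fun _ _ => norm_nonneg _) fun i _ => hC i M z hz

/-- The factor `1/z` compensates the length of the circle, leaving the geometric decay of the ratio.
-/
theorem tendsto_circleIntegral_qPochRatio {N : ℕ} {A B : Fin N → ℂ} {q : ℂ} (hq0 : q ≠ 0)
    (hq : ‖q‖ < 1) (hA : ∀ i, A i ≠ 0) (hB : ∀ i, B i ≠ 0) (hB1 : ∀ i, ‖B i‖ < 1)
    (hκ : ‖∏ i, A i / B i‖ < 1) {r : ℝ} (hr0 : 0 < r) (hr1 : r < 1)
    (hr : ∀ i, ∀ e : ℤ, ‖B i‖ * ‖q‖ ^ e ≠ r) :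
    Tendsto (fun M : ℕ => ∮ z in C(0, ‖q‖ ^ M * r), qPochRatio A B q z / z) atTop (𝓝 0) := by
  obtain ⟨C, hC⟩ := exists_forall_norm_qPochRatio_le hq0 hq hA hB hB1 hr0 hr1 hr
  have hlim : Tendsto (fun M : ℕ => 2 * Real.pi * (‖∏ i, A i / B i‖ ^ M * C)) atTop (𝓝 0) := by
    simpa using ((tendsto_pow_atTop_nhds_zero_of_lt_one (norm_nonneg _) hκ).mul_const C).const_mul
      (2 * Real.pi)
  refine squeeze_zero_norm (fun M => ?_) hlim
  have hρ : 0 < ‖q‖ ^ M * r := mul_pos (pow_pos (norm_pos_iff.2 hq0) M) hr0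
  refine (circleIntegral.norm_integral_le_of_norm_le_const hρ.le
    (C := (‖∏ i, A i / B i‖ ^ M * C) / (‖q‖ ^ M * r)) fun z hz => ?_).trans_eq ?_
  · have hz' : ‖z‖ = ‖q‖ ^ M * r := by simpa using hz
    rw [norm_div, hz']
    refine div_le_div_of_nonneg_right ?_ hρ.le
    have hqM : q ^ M ≠ 0 := pow_ne_zero _ hq0
    have := hC M (z / q ^ M) (by
      rw [norm_div, hz', norm_pow, mul_div_cancel_left₀ _ (by positivity)])
    rwa [mul_div_cancel₀ _ hqM] at this
  · field_simp

theorem mul_qPoch_mul_inv {B q z : ℂ} (hz : z ≠ 0) (K : ℕ) :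
    z ^ K * qPoch (B * z⁻¹) q K = ∏ m ∈ Finset.range K, (z - B * q ^ m) := by
  have hc : z ^ K = ∏ _l ∈ Finset.range K, z := by simp
  rw [qPoch, hc, ← Finset.prod_mul_distrib]
  refine Finset.prod_congr rfl fun m _ => ?_
  field_simp

/-- Extracts the first `K` poles of each family, giving the form `G / ∏ (z - vᵢ)` that the residue
theorem needs. -/
theorem qPochRatio_div_eq {n : ℕ} {A B : Fin n → ℂ} {q z : ℂ} (hq : ‖q‖ < 1) (hz : z ≠ 0) (K : ℕ) :
    qPochRatio A B q z / z = (z⁻¹ * ∏ i, z ^ K * (qPochInf (A i * z) q * qPochInf (A i * z⁻¹) q) /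
      (qPochInf (B i * z) q * qPochInf (B i * q ^ K * z⁻¹) q)) /
      ∏ p ∈ Finset.univ ×ˢ Finset.range K, (z - B p.1 * q ^ p.2) := by
  rw [Finset.prod_product, div_eq_inv_mul, mul_div_assoc, ← Finset.prod_div_distrib, qPochRatio]
  congr 1
  refine Finset.prod_congr rfl fun i _ => ?_
  have h1 := mul_qPoch_mul_inv (B := B i) (q := q) hz K
  rw [← h1, qPochInf_eq_qPoch_mul (B i * z⁻¹) hq K,
    show B i * z⁻¹ * q ^ K = B i * q ^ K * z⁻¹ by ring]
  have hzK := pow_ne_zero K hz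
  generalize z ^ K = w at *
  field_simp

theorem tendsto_sub_mul_qPochRatio {n : ℕ} {A B : Fin (n + 1) → ℂ} {q : ℂ} (hq0 : q ≠ 0)
    (hq : ‖q‖ < 1) (hB : ∀ i, B i ≠ 0) (hB1 : ∀ i, ‖B i‖ < 1)
    (hgen : ∀ i j, i ≠ j → ∀ e : ℤ, B i ≠ q ^ e * B j) (j : Fin (n + 1)) (m : ℕ) :
    Tendsto (fun z => (z - B j * q ^ m) * (qPochRatio A B q z / z)) (𝓝[≠] (B j * q ^ m))
      (𝓝 (qPochRatioResidue A B q j m)) := by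
  have hp0 : B j * q ^ m ≠ 0 := mul_ne_zero (hB j) (pow_ne_zero _ hq0)
  set p := B j * q ^ m with hp
  have hp1 : ‖p‖ < 1 := by
    rw [hp, norm_mul, norm_pow]
    exact mul_lt_one_of_nonneg_of_lt_one_left (norm_nonneg _) (hB1 j)
      (pow_le_one₀ (norm_nonneg _) hq.le)
  have hBp : B j * p⁻¹ = (q ^ m)⁻¹ := by
    rw [hp, mul_inv, mul_inv_cancel_left₀ (hB j)]
  have hcont : ContinuousAt (fun z => (∏ i, qPochInf (A i * z) q * qPochInf (A i * z⁻¹) q /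
      qPochInf (B i * z) q) / ((∏ i, qPochInf (B (j.succAbove i) * z⁻¹) q) *
      (qPoch (B j * z⁻¹) q m * qPochInf (B j * z⁻¹ * q ^ (m + 1)) q))) p := by
    have hc := (differentiable_qPochInf hq).continuous
    have hm : ∀ c : ℂ, ContinuousAt (fun z => qPochInf (c * z) q) p := fun c =>
      (hc.comp (continuous_const.mul continuous_id)).continuousAt
    have hinv : ∀ c : ℂ, ContinuousAt (fun z : ℂ => c * z⁻¹) p := fun c =>
      continuousAt_const.mul (continuousAt_inv₀ hp0)
    have hi : ∀ c : ℂ, ContinuousAt (fun z => qPochInf (c * z⁻¹) q) p := fun c =>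
      hc.continuousAt.comp (hinv c)
    have hi' : ContinuousAt (fun z => qPochInf (B j * z⁻¹ * q ^ (m + 1)) q) p :=
      hc.continuousAt.comp ((hinv (B j)).mul_const _)
    have hf : ContinuousAt (fun z => qPoch (B j * z⁻¹) q m) p :=
      tendsto_finsetProd _ fun l _ => tendsto_const_nhds.sub ((hinv (B j)).mul_const _)
    refine ContinuousAt.div ?_ ?_ ?_
    · refine tendsto_finsetProd _ fun i _ => ?_
      refine ((hm (A i)).mul (hi (A i))).div (hm (B i)) (qPochInf_ne_zero_of_norm_lt_one hq ?_)
      rw [norm_mul]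
      exact mul_lt_one_of_nonneg_of_lt_one_left (norm_nonneg _) (hB1 i) hp1.le
    · exact (tendsto_finsetProd _ fun i _ => hi _).mul (hf.mul hi')
    · refine mul_ne_zero (Finset.prod_ne_zero_iff.2 fun i _ => ?_) (mul_ne_zero ?_ ?_)
      · refine qPochInf_ne_zero hq fun l hl => hgen (j.succAbove i) j (Fin.succAbove_ne j i)
          ((m : ℤ) - l) ?_
        rw [zpow_sub₀ hq0, zpow_natCast, zpow_natCast]
        field_simp at hl ⊢
        rw [hl, hp, mul_comm]
      · rw [hBp]
        refine qPoch_ne_zero_iff.2 fun l hl h => hl.ne (pow_injective_of_norm_lt_one hq0 hq ?_)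
        have := pow_ne_zero m hq0
        field_simp at h
        exact h
      · rw [hBp, pow_succ, inv_mul_cancel_left₀ (pow_ne_zero m hq0)]
        exact qPochInf_ne_zero_of_norm_lt_one hq hq
  refine (hcont.tendsto.mono_left nhdsWithin_le_nhds).congr' ?_
  have hz0 : ∀ᶠ z in 𝓝[≠] p, z ≠ 0 := (eventually_ne_nhds hp0).filter_mono nhdsWithin_le_nhds
  filter_upwards [hz0, self_mem_nhdsWithin] with z hz hzp
  have hzp' : z - p ≠ 0 := sub_ne_zero.2 hzp
  -- The factor of index `m` is the only one vanishing at `p`; its `z` cancels the `1/z` of the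
  -- integrand.
  have h1 : qPochInf (B j * z⁻¹) q = qPoch (B j * z⁻¹) q m * ((z - p) / z) *
      qPochInf (B j * z⁻¹ * q ^ (m + 1)) q := by
    rw [qPochInf_eq_qPoch_mul _ hq (m + 1), qPoch_add]
    congr 2
    rw [qPoch, Finset.prod_range_one, hp]
    field_simp
  have h2 : qPochRatio A B q z = (∏ i, qPochInf (A i * z) q * qPochInf (A i * z⁻¹) q /
      qPochInf (B i * z) q) / ∏ i, qPochInf (B i * z⁻¹) q := by
    rw [← Finset.prod_div_distrib, qPochRatio]
    exact Finset.prod_congr rfl fun i _ => by rw [div_div]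
  rw [h2, Fin.prod_univ_succAbove (fun i => qPochInf (B i * z⁻¹) q) j, h1]
  generalize (∏ i, qPochInf (A i * z) q * qPochInf (A i * z⁻¹) q / qPochInf (B i * z) q) = X
  field_simp

theorem circleIntegral_qPochRatio_eq_add_sum {n : ℕ} {A B : Fin (n + 1) → ℂ} {q : ℂ} (hq0 : q ≠ 0)
    (hq : ‖q‖ < 1) (hB : ∀ i, B i ≠ 0) (hB1 : ∀ i, ‖B i‖ < 1)
    (hgen : ∀ i j, i ≠ j → ∀ e : ℤ, B i ≠ q ^ e * B j) {ρ : ℝ} (hρ0 : 0 < ρ) (hρ1 : ρ ≤ 1)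
    (hρ : ∀ i, ∀ m : ℕ, ‖B i‖ * ‖q‖ ^ m ≠ ρ) {K : ℕ} (hK0 : 0 < K)
    (hK : ∀ i, ‖B i‖ * ‖q‖ ^ K < ρ) :
    (∮ z in C(0, 1), qPochRatio A B q z / z) = (∮ z in C(0, ρ), qPochRatio A B q z / z) +
      2 * Real.pi * Complex.I * ∑ p ∈ (Finset.univ ×ˢ Finset.range K) with
        ρ < ‖B p.1 * q ^ p.2‖, qPochRatioResidue A B q p.1 p.2 := by
  -- On this open set neither `(Bᵢz; q)_∞` nor the tail `(Bᵢqᴷ/z; q)_∞` vanishes.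
  set U : Set ℂ := {z | 0 < ‖z‖ ∧ ∀ i, ‖B i‖ * ‖z‖ < 1 ∧ ‖B i‖ * ‖q‖ ^ K < ‖z‖}
  have hU : IsOpen U := by
    have : U = {z | 0 < ‖z‖} ∩ ⋂ i, {z | ‖B i‖ * ‖z‖ < 1} ∩ {z | ‖B i‖ * ‖q‖ ^ K < ‖z‖} := by
      ext z; simp [U]
    rw [this]
    refine (isOpen_lt (by fun_prop) (by fun_prop)).inter (isOpen_iInter_of_finite fun i => ?_)
    exact (isOpen_lt (by fun_prop) (by fun_prop)).inter (isOpen_lt (by fun_prop) (by fun_prop))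
  have hU0 : ∀ z ∈ U, z ≠ 0 := fun z hz => norm_pos_iff.1 hz.1
  refine circleIntegral_eq_add_sum_residues hU hρ0 hρ1 ?_
    (G := fun z => z⁻¹ * ∏ i, z ^ K * (qPochInf (A i * z) q * qPochInf (A i * z⁻¹) q) /
      (qPochInf (B i * z) q * qPochInf (B i * q ^ K * z⁻¹) q)) ?_
    (v := fun p : Fin (n + 1) × ℕ => B p.1 * q ^ p.2) ?_ ?_ ?_ ?_ ?_ ?_
  · rintro z ⟨h1, h2⟩
    have h1 : ‖z‖ ≤ 1 := by simpa using h1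
    have h2 : ρ ≤ ‖z‖ := by simpa using h2
    exact ⟨hρ0.trans_le h2, fun i => ⟨mul_lt_one_of_nonneg_of_lt_one_left (norm_nonneg _) (hB1 i) h1,
      (hK i).trans_le h2⟩⟩
  · intro z hz
    have hd := differentiable_qPochInf hq
    have hz0 := hU0 z hz
    have hm : ∀ c : ℂ, DifferentiableAt ℂ (fun z => qPochInf (c * z) q) z := fun c =>
      (hd _).comp z (differentiableAt_id.const_mul c)
    have hi : ∀ c : ℂ, DifferentiableAt ℂ (fun z => qPochInf (c * z⁻¹) q) z := fun c =>
      (hd _).comp z ((differentiableAt_inv hz0).const_mul c)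
    refine ((differentiableAt_inv hz0).mul
      (DifferentiableAt.fun_finsetProd fun i _ => ?_)).differentiableWithinAt
    refine ((differentiableAt_id.pow K).mul ((hm _).mul (hi _))).div ((hm _).mul (hi _))
      (mul_ne_zero (qPochInf_ne_zero_of_norm_lt_one hq ?_)
        (qPochInf_ne_zero_of_norm_lt_one hq ?_))
    · rw [norm_mul]; exact (hz.2 i).1
    · rw [norm_mul, norm_mul, norm_pow, norm_inv, ← div_eq_mul_inv, div_lt_one hz.1]
      exact (hz.2 i).2
  · exact ⟨(0, 0), by simpa using hK0⟩
  · rintro ⟨i, l⟩ - ⟨j, m⟩ - h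
    simp only at h
    have hij : i = j := by
      by_contra hij
      refine hgen i j hij ((m : ℤ) - l) ?_
      rw [zpow_sub₀ hq0, zpow_natCast, zpow_natCast]
      field_simp
      rw [h, mul_comm]
    subst hij
    rw [pow_injective_of_norm_lt_one hq0 hq (mul_left_cancel₀ (hB i) h)]
  · rintro ⟨i, l⟩ -
    rw [norm_mul, norm_pow]
    exact mul_lt_one_of_nonneg_of_lt_one_left (norm_nonneg _) (hB1 i)
      (pow_le_one₀ (norm_nonneg _) hq.le)
  · rintro ⟨i, l⟩ -
    rw [norm_mul, norm_pow]
    exact hρ i l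
  · exact fun z hz _ => qPochRatio_div_eq hq (hU0 z hz) K
  · rintro ⟨i, l⟩ -
    exact tendsto_sub_mul_qPochRatio hq0 hq hB hB1 hgen i l

theorem circleIntegral_qPochRatio_eq_tsum {n : ℕ} {A B : Fin (n + 1) → ℂ} {q : ℂ} (hq0 : q ≠ 0)
    (hq : ‖q‖ < 1) (hA : ∀ i, A i ≠ 0) (hB : ∀ i, B i ≠ 0) (hB1 : ∀ i, ‖B i‖ < 1)
    (hκ : ‖∏ i, A i / B i‖ < 1) (hgen : ∀ i j, i ≠ j → ∀ e : ℤ, B i ≠ q ^ e * B j)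
    (hsum : Summable fun p : Fin (n + 1) × ℕ => qPochRatioResidue A B q p.1 p.2) :
    (2 * Real.pi * Complex.I)⁻¹ * (∮ z in C(0, 1), qPochRatio A B q z / z) =
      ∑' p : Fin (n + 1) × ℕ, qPochRatioResidue A B q p.1 p.2 := by
  have hqp : 0 < ‖q‖ := norm_pos_iff.2 hq0
  -- Only countably many radii are forbidden, so an admissible one exists.
  obtain ⟨r, ⟨hr0, hr1⟩, hr⟩ : ∃ r ∈ Set.Ioo (0 : ℝ) 1,
      r ∈ (Set.range fun p : Fin (n + 1) × ℤ => ‖B p.1‖ * ‖q‖ ^ p.2)ᶜ :=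
    ((Set.countable_range _).dense_compl ℝ).inter_open_nonempty _ isOpen_Ioo
      (Set.nonempty_Ioo.2 one_pos)
  replace hr : ∀ i, ∀ e : ℤ, ‖B i‖ * ‖q‖ ^ e ≠ r := fun i e h => hr ⟨(i, e), h⟩
  -- The norm bound puts every pole of index at least `K` inside the small circle; `M < K` makes the
  -- finite pole sets `S M` exhaust all pairs.
  have hKex : ∀ M : ℕ, ∃ K, M < K ∧ ∀ i, ‖B i‖ * ‖q‖ ^ K < ‖q‖ ^ M * r := by
    intro M
    have h1 : ∀ᶠ K : ℕ in atTop, ‖q‖ ^ K < ‖q‖ ^ M * r :=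
      (tendsto_pow_atTop_nhds_zero_of_lt_one (norm_nonneg _) hq).eventually_lt_const (by positivity)
    obtain ⟨K, h2, h3⟩ := (h1.and (eventually_gt_atTop M)).exists
    exact ⟨K, h3, fun i => lt_of_le_of_lt (mul_le_of_le_one_left (by positivity) (hB1 i).le) h2⟩
  choose K hKM hK using hKex
  set S : ℕ → Finset (Fin (n + 1) × ℕ) := fun M =>
    (Finset.univ ×ˢ Finset.range (K M)).filter fun p => ‖q‖ ^ M * r < ‖B p.1 * q ^ p.2‖
  have hS : Tendsto S atTop atTop := by
    refine tendsto_atTop.2 fun T => ?_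
    have : ∀ᶠ M in atTop, ∀ p ∈ T, p ∈ S M := by
      refine (Finset.eventually_all T).2 fun p _ => ?_
      have hlim : Tendsto (fun M : ℕ => ‖q‖ ^ M * r) atTop (𝓝 0) := by
        simpa using (tendsto_pow_atTop_nhds_zero_of_lt_one (norm_nonneg _) hq).mul_const r
      filter_upwards [hlim.eventually_lt_const
        (norm_pos_iff.2 (mul_ne_zero (hB p.1) (pow_ne_zero p.2 hq0))), eventually_ge_atTop p.2]
        with M h1 h2
      simp only [S, Finset.mem_filter, Finset.mem_product, Finset.mem_univ, Finset.mem_range,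
        true_and]
      exact ⟨h2.trans_lt (hKM M), h1⟩
    exact this.mono fun M hM p hp => hM p hp
  have hpi : (2 * Real.pi * Complex.I) ≠ 0 := Complex.two_pi_I_ne_zero
  have heq : ∀ M, (∮ z in C(0, 1), qPochRatio A B q z / z) =
      (∮ z in C(0, ‖q‖ ^ M * r), qPochRatio A B q z / z) +
      2 * Real.pi * Complex.I * ∑ p ∈ S M, qPochRatioResidue A B q p.1 p.2 := fun M =>
    circleIntegral_qPochRatio_eq_add_sum hq0 hq hB hB1 hgen (by positivity)
      (mul_le_one₀ (pow_le_one₀ hqp.le hq.le) hr0.le hr1.le)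
      (fun i m h => hr i ((m : ℤ) - M) (by
        rw [zpow_sub₀ hqp.ne', zpow_natCast, zpow_natCast]
        field_simp
        linarith)) ((Nat.zero_le M).trans_lt (hKM M)) (hK M)
  have hlim := (tendsto_circleIntegral_qPochRatio hq0 hq hA hB hB1 hκ hr0 hr1 hr).add
    ((hsum.hasSum.comp hS).const_mul (2 * Real.pi * Complex.I))
  have := tendsto_nhds_unique (tendsto_const_nhds.congr heq) hlim
  rw [this, zero_add, inv_mul_cancel_left₀ hpi]

theorem circleIntegrable_qPochRatio {N : ℕ} {A B : Fin N → ℂ} {q : ℂ} (hq : ‖q‖ < 1)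
    (hB1 : ∀ i, ‖B i‖ < 1) : CircleIntegrable (fun z => qPochRatio A B q z / z) 0 1 := by
  refine ContinuousOn.circleIntegrable zero_le_one fun z hz => ContinuousAt.continuousWithinAt ?_
  have hz1 : ‖z‖ = 1 := by simpa using hz
  have hz0 : z ≠ 0 := norm_pos_iff.1 (by rw [hz1]; exact one_pos)
  have hc := (differentiable_qPochInf hq).continuous
  have hm : ∀ c : ℂ, ContinuousAt (fun z => qPochInf (c * z) q) z := fun c =>
    (hc.comp (continuous_const.mul continuous_id)).continuousAt
  have hi : ∀ c : ℂ, ContinuousAt (fun z => qPochInf (c * z⁻¹) q) z := fun c =>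
    hc.continuousAt.comp (f := fun z : ℂ => c * z⁻¹) (continuousAt_const.mul (continuousAt_inv₀ hz0))
  refine ContinuousAt.div (tendsto_finsetProd _ fun i _ => ?_) continuousAt_id hz0
  refine ((hm _).mul (hi _)).div ((hm _).mul (hi _)) (mul_ne_zero ?_ ?_)
  all_goals
    refine qPochInf_ne_zero_of_norm_lt_one hq ?_
    simpa [hz1] using hB1 i

/-! ### Convergence of the series and resummation over flux. -/

theorem summable_basicHypTerm {r : ℕ} (A : Fin (r + 1) → ℂ) {B : Fin r → ℂ} {q z : ℂ}
    (hq : ‖q‖ < 1) (hz : ‖z‖ < 1) (hB : ∀ i, ∀ l : ℕ, B i * q ^ l ≠ 1) :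
    Summable (basicHypTerm A B q z) := by
  have h1 : Tendsto (fun m => (∏ i, qPoch (A i) q m) / (qPoch q q m * ∏ i, qPoch (B i) q m)) atTop
      (𝓝 ((∏ i, qPochInf (A i) q) / (qPochInf q q * ∏ i, qPochInf (B i) q))) :=
    (tendsto_finsetProd _ fun i _ => tendsto_qPoch _ hq).div
      ((tendsto_qPoch _ hq).mul (tendsto_finsetProd _ fun i _ => tendsto_qPoch _ hq))
      (mul_ne_zero (qPochInf_ne_zero_of_norm_lt_one hq hq)
        (Finset.prod_ne_zero_iff.2 fun i _ => qPochInf_ne_zero hq (hB i)))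
  obtain ⟨C, hC⟩ := h1.norm.bddAbove_range
  refine Summable.of_norm_bounded
    ((summable_geometric_of_lt_one (norm_nonneg z) hz).mul_left C) fun m => ?_
  rw [basicHypTerm, norm_mul, norm_pow]
  exact mul_le_mul_of_nonneg_right (hC ⟨m, rfl⟩) (by positivity)

/-- `(k, m) ↦ (m + k⁺, m + k⁻)`. -/
def intProdNatEquiv : ℤ × ℕ ≃ ℕ × ℕ where
  toFun p := (p.2 + p.1.toNat, p.2 + (-p.1).toNat)
  invFun p := ((p.1 : ℤ) - p.2, min p.1 p.2)
  left_inv p := by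
    rcases p with ⟨k, m⟩
    ext
    · simp
    · simp; omega
  right_inv p := by
    rcases p with ⟨u, v⟩
    ext <;> simp <;> omega

/-- Index the terms of the squared series by the difference `k` and the minimum `m` of the two
indices: these indices are then `|k| + m` and `m` in some order, and the product is symmetric. -/
theorem hasSum_natAbs_add_mul {f : ℕ → ℂ} (hf : Summable f) :
    HasSum (fun p : ℤ × ℕ => f (p.1.natAbs + p.2) * f p.2) ((∑' m, f m) ^ 2) := by
  have h1 : HasSum (fun p : ℕ × ℕ => f p.1 * f p.2) ((∑' m, f m) ^ 2) := by
    rw [sq]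
    exact hf.hasSum.mul hf.hasSum (summable_mul_of_summable_norm hf.norm hf.norm)
  refine ((intProdNatEquiv.hasSum_iff).2 h1).congr_fun ?_
  rintro ⟨k, m⟩
  simp only [Function.comp, intProdNatEquiv, Equiv.coe_fn_mk]
  rcases le_total 0 k with hk | hk
  · rw [show m + k.toNat = k.natAbs + m by omega, show m + (-k).toNat = m by omega]
  · rw [show m + k.toNat = m by omega, show m + (-k).toNat = k.natAbs + m by omega, mul_comm]

theorem summable_prod_of_finite {ι : Type*} [Finite ι] {f : ι → ℕ → ℂ} (hf : ∀ i, Summable (f i)) :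
    Summable fun p : ι × ℕ => f p.1 p.2 :=
  Summable.of_norm ((summable_prod_of_nonneg fun _ => norm_nonneg _).2
    ⟨fun i => (hf i).norm, .of_finite⟩)

/-! ### Residues of the electric integrand. -/

section

variable {n : ℕ} {q a x b : ℂ} {t : Fin (n + 1) → ℂ}

theorem denParam_mul_pow_ne_one (ht : ∀ i, t i ≠ 0)
    (hgen : ∀ i j, i ≠ j → ∀ m : ℤ, t i ≠ q ^ m * t j) (j : Fin (n + 1)) (i : Fin n) (l : ℕ) :
    denParam q t j i * q ^ l ≠ 1 := by
  intro h
  refine hgen (j.succAbove i) j (Fin.succAbove_ne j i) ((l + 1 : ℕ) : ℤ) ?_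
  have := ht (j.succAbove i)
  rw [denParam] at h
  rw [zpow_natCast, pow_succ]
  field_simp at h
  rw [← h]
  ring

/-- `|q tⱼ tᵢ|` is the geometric mean of `|q tⱼ²|` and `|q tᵢ²|`. -/
theorem norm_numParam_lt_one (hqa : ∀ i, ‖q * t i ^ 2‖ < ‖a‖) (j i : Fin (n + 1)) :
    ‖numParam q a t j i‖ < 1 := by
  have ha : 0 < ‖a‖ := (norm_nonneg _).trans_lt (hqa j)
  rw [numParam, norm_div, div_lt_one ha]
  refine lt_of_pow_lt_pow_left₀ 2 ha.le ?_
  calc ‖q * t j * t i‖ ^ 2 = ‖q * t j ^ 2‖ * ‖q * t i ^ 2‖ := by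
        rw [← norm_pow, ← norm_mul]; congr 1; ring
    _ < ‖a‖ * ‖a‖ := mul_lt_mul'' (hqa j) (hqa i) (norm_nonneg _) (norm_nonneg _)
    _ = ‖a‖ ^ 2 := by ring

/-- Final bookkeeping for the residue formula: only the factors that actually cancel need to be
nonzero. -/
theorem div_mul_residue_cancel {Q P Qk Dk z₁ z₂ z₃ z₄ Xm Y Z Xk Dm E Qm B₁ B₂ : ℂ} (hQ : Q ≠ 0)
    (h₁ : z₁ ≠ 0) (h₂ : z₂ ≠ 0) (h₃ : z₃ ≠ 0) (h₄ : z₄ ≠ 0) :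
    B₁ * B₂ / z₁ * (Q * P / (Qk * Dk) * (z₁ * z₂ * (z₃ * z₄) * Xm * Y) / (Z / Xk) /
      (z₂ * z₃ * Dm * E * (z₄ * Qm * Q))) =
    Y * P / (E * Z) * (Xk / (Qk * Dk) * B₁ * (Xm / (Qm * Dm) * B₂)) := by
  trans Y * P / (E * Z) * (Xk / (Qk * Dk) * B₁ * (Xm / (Qm * Dm) * B₂)) *
    ((z₁ * z₁⁻¹) * (z₂ * z₂⁻¹) * (z₃ * z₃⁻¹) * (z₄ * z₄⁻¹) * (Q * Q⁻¹))
  · simp only [div_eq_mul_inv, mul_inv, inv_inv]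
    ring
  · simp only [mul_inv_cancel₀ hQ, mul_inv_cancel₀ h₁, mul_inv_cancel₀ h₂, mul_inv_cancel₀ h₃,
      mul_inv_cancel₀ h₄, mul_one]

/-- Products with `z = Bⱼqᵐ` carry `q^(k+m)` and yield the term of index `k + m`; quotients by `z`
carry `q⁻ᵐ` and, after reflection, yield the term of index `m`. Half-integral powers combine through
`x² = q` and `b² = a`. -/
theorem pow_mul_qPochRatioResidue (hx : x ^ 2 = q) (hb : b ^ 2 = a) (hq0 : q ≠ 0) (hq1 : ‖q‖ < 1)
    (ha0 : a ≠ 0) (ht : ∀ i, t i ≠ 0) (hprod : ∏ i, t i = 1) (hqa : ∀ i, ‖q * t i ^ 2‖ < ‖a‖)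
    (hgen : ∀ i j, i ≠ j → ∀ m : ℤ, t i ≠ q ^ m * t j) (k : ℕ) (j : Fin (n + 1)) (m : ℕ) :
    b ^ ((n + 1) * k) * qPochRatioResidue (fun i => b * x ^ (1 + k) * (t i)⁻¹)
      (fun i => b⁻¹ * x ^ (1 + k) * t i) q j m =
    prodPrefactor q a t j *
      (basicHypTerm (numParam q a t j) (denParam q t j) q (b ^ (n + 1)) (k + m) *
        basicHypTerm (numParam q a t j) (denParam q t j) q (b ^ (n + 1)) m) := by
  have hx0 : x ≠ 0 := by rintro rfl; exact hq0 (by rw [← hx]; simp)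
  have hb0 : b ≠ 0 := by rintro rfl; exact ha0 (by rw [← hb]; simp)
  have htj := ht j
  have hqm := pow_ne_zero m hq0
  have hsq : x ^ (1 + k) * x ^ (1 + k) = q * q ^ k := by
    rw [← hx]; ring
  have e1 : ∀ i, b * x ^ (1 + k) * (t i)⁻¹ * (b⁻¹ * x ^ (1 + k) * t j * q ^ m) =
      q * t j / t i * q ^ (k + m) := fun i => by
    calc _ = b * b⁻¹ * (x ^ (1 + k) * x ^ (1 + k)) * (t j * (t i)⁻¹) * q ^ m := by ring
      _ = _ := by rw [hsq, mul_inv_cancel₀ hb0]; ring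
  have e2 : ∀ i, b * x ^ (1 + k) * (t i)⁻¹ * (b⁻¹ * x ^ (1 + k) * t j * q ^ m)⁻¹ =
      a / (t j * t i) / q ^ m := fun i => by
    have := ht i
    rw [← hb]
    field_simp
  have e3 : ∀ i, b⁻¹ * x ^ (1 + k) * t i * (b⁻¹ * x ^ (1 + k) * t j * q ^ m) =
      q * t j * t i / a * q ^ (k + m) := fun i => by
    calc _ = b⁻¹ * b⁻¹ * (x ^ (1 + k) * x ^ (1 + k)) * (t j * t i) * q ^ m := by ring
      _ = _ := by rw [hsq, ← hb]; field_simp; ring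
  have e4 : ∀ i, b⁻¹ * x ^ (1 + k) * t i * (b⁻¹ * x ^ (1 + k) * t j * q ^ m)⁻¹ =
      t i / t j / q ^ m := fun i => by
    field_simp
  have e5 : t j / t j / q ^ m * q ^ (m + 1) = q := by
    rw [div_self htj, pow_succ]; field_simp
  have hq_ne : ∀ M, qPoch q q M ≠ 0 := fun M =>
    qPoch_ne_zero_iff.2 fun l _ => mul_pow_ne_one_of_norm_lt_one hq1 hq1 l
  have hden : ∀ i M, qPoch (q * t j / t i) q M ≠ 0 := by
    intro i M
    rcases Fin.eq_self_or_eq_succAbove j i with rfl | ⟨i, rfl⟩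
    · rw [mul_div_assoc, div_self htj, mul_one]; exact hq_ne M
    · exact qPoch_ne_zero_iff.2 fun l _ => denParam_mul_pow_ne_one ht hgen j i l
  have hnum : ∀ i M, qPoch (q * t j * t i / a) q M ≠ 0 := fun i M =>
    qPoch_ne_zero_iff.2 fun l _ =>
      mul_pow_ne_one_of_norm_lt_one hq1 (norm_numParam_lt_one hqa j i) l
  have f1 : ∀ y : ℂ, qPoch y q (k + m) ≠ 0 →
      qPochInf (y * q ^ (k + m)) q = qPochInf y q / qPoch y q (k + m) := fun y hy => by
    rw [qPochInf_eq_qPoch_mul y hq1 (k + m), mul_div_cancel_left₀ _ hy]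
  have e6 : ∀ i, q / (a / (t j * t i)) = q * t j * t i / a := fun i => by
    rw [div_div_eq_mul_div, mul_assoc]
  have e7 : ∀ i, q / (t i / t j) = q * t j / t i := fun i => by
    rw [div_div_eq_mul_div]
  have hat : ∀ i, a / (t j * t i) ≠ 0 := fun i => div_ne_zero ha0 (mul_ne_zero htj (ht i))
  have htt : ∀ i, t i / t j ≠ 0 := fun i => div_ne_zero (ht i) htj
  have hc : (∏ l ∈ Finset.range m, -(q ^ (l + 1))⁻¹) ≠ 0 :=
    Finset.prod_ne_zero_iff.2 fun l _ => neg_ne_zero.2 (inv_ne_zero (pow_ne_zero _ hq0))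
  -- This uses `∏ tᵢ = 1`. The reflection powers of numerator and denominator then differ by
  -- `a^((n+1)m)` alone.
  have hT : ∏ i, a / (t j * t i) = a ^ (n + 1) * ∏ i : Fin n, t (j.succAbove i) / t j := by
    have h1 : ∏ i, t i / t j = ∏ i : Fin n, t (j.succAbove i) / t j := by
      rw [Fin.prod_univ_succAbove _ j, div_self htj, one_mul]
    rw [← h1, Finset.prod_div_distrib, Finset.prod_div_distrib, Finset.prod_mul_distrib, hprod]
    simp [div_eq_mul_inv]
  have hT0 : ∏ i : Fin n, t (j.succAbove i) / t j ≠ 0 :=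
    Finset.prod_ne_zero_iff.2 fun i _ => htt _
  simp only [qPochRatioResidue, e1, e2, e3, e4, e5]
  simp only [qPoch_div_pow (htt _) hq0, qPochInf_div_pow (hat _) hq0 hq1,
    qPochInf_div_pow (htt _) hq0 hq1, f1 _ (hden _ _), f1 _ (hnum _ _), e6, e7]
  simp only [Finset.prod_mul_distrib, Finset.prod_div_distrib, Finset.prod_pow, hT,
    Finset.prod_const, Finset.card_univ, Fintype.card_fin]
  have s1 : ∏ i, qPochInf (q * t j / t i) q =
      qPochInf q q * ∏ i : Fin n, qPochInf (q * t j / t (j.succAbove i)) q := by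
    rw [Fin.prod_univ_succAbove _ j, mul_div_assoc, div_self htj, mul_one]
  have s2 : ∏ i, qPoch (q * t j / t i) q (k + m) =
      qPoch q q (k + m) * ∏ i, qPoch (denParam q t j i) q (k + m) := by
    rw [Fin.prod_univ_succAbove _ j, mul_div_assoc, div_self htj, mul_one]; rfl
  have s3 : prodPrefactor q a t j = (∏ i, qPochInf (a / (t j * t i)) q) *
      (∏ i : Fin n, qPochInf (q * t j / t (j.succAbove i)) q) /
      ((∏ i : Fin n, qPochInf (t (j.succAbove i) / t j) q) *
        ∏ i, qPochInf (q * t j * t i / a) q) := by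
    rw [prodPrefactor, Fin.prod_univ_succAbove (fun i => qPochInf (a / (t j * t i)) q) j,
      Fin.prod_univ_succAbove (fun i => qPochInf (q * t j * t i / a) q) j,
      Finset.prod_div_distrib, Finset.prod_mul_distrib, Finset.prod_mul_distrib,
      show q * t j ^ 2 / a = q * t j * t j / a by ring, sq, div_mul_div_comm]
    congr 1 <;> ring
  rw [s1, s2, s3]
  simp only [basicHypTerm]
  change _ = _ * ((∏ i, qPoch (q * t j * t i / a) q (k + m)) / _ * _ *
    ((∏ i, qPoch (q * t j * t i / a) q m) /
      (_ * ∏ i : Fin n, qPoch (q * t j / t (j.succAbove i)) q m) * _))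
  have hqinf := qPochInf_ne_zero_of_norm_lt_one hq1 hq1
  have hpow : b ^ ((n + 1) * k) * (a ^ (n + 1)) ^ m =
      (b ^ (n + 1)) ^ (k + m) * (b ^ (n + 1)) ^ m := by
    rw [← hb]; ring
  have hpow' : b ^ ((n + 1) * k) =
      (b ^ (n + 1)) ^ (k + m) * (b ^ (n + 1)) ^ m / (a ^ (n + 1)) ^ m := by
    rw [← hpow, mul_div_cancel_right₀ _ (pow_ne_zero _ (pow_ne_zero _ ha0))]
  simp only [Finset.prod_div_distrib, Finset.prod_const, Finset.card_univ, Fintype.card_fin] at hT0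
  -- The `n + 1` reflection constants of the numerator are split as `n` and one: the denominator has
  -- `n` from `i ≠ j` and one from `(q⁻ᵐ; q)_m`.
  rw [hpow', mul_pow, div_self htj, one_pow, one_mul, mul_div_cancel_right₀ q htj,
    pow_succ (∏ l ∈ Finset.range m, -(q ^ (l + 1))⁻¹) n]
  exact div_mul_residue_cancel hqinf (pow_ne_zero m (pow_ne_zero (n + 1) ha0))
    (pow_ne_zero m hT0) (pow_ne_zero n hc) hc

end

/-! ### Assembly of the index. -/

theorem mainTheorem6 (n : ℕ) (q a x b : ℂ) (t : Fin (n + 1) → ℂ)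
    (hx : x ^ 2 = q) (hb : b ^ 2 = a)
    (hq0 : q ≠ 0) (hq1 : ‖q‖ < 1) (ha : ‖a‖ < 1)
    (ht : ∏ i, t i = 1)
    (hqa : ∀ i, ‖q * t i ^ 2‖ < ‖a‖)
    (hgen : ∀ i j, i ≠ j → ∀ m : ℤ, t i ≠ q ^ m * t j) :
    (∀ k : ℤ, CircleIntegrable (fun z => electricIntegrand x b t k z / z) 0 1) ∧
    (Summable fun k : ℤ => electricTerm x b t k) ∧
    (∀ j, Summable fun m : ℕ =>
      basicHypTerm (numParam q a t j) (denParam q t j) q (b ^ (n + 1)) m) ∧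
    electricIndex x b t =
      ∑ j, prodPrefactor q a t j *
        basicHyp (numParam q a t j) (denParam q t j) q (b ^ (n + 1)) ^ 2 := by
  have ha0 : a ≠ 0 := norm_pos_iff.1 ((norm_nonneg _).trans_lt (hqa 0))
  have hx0 : x ≠ 0 := by rintro rfl; exact hq0 (by rw [← hx]; simp)
  have hb0 : b ≠ 0 := by rintro rfl; exact ha0 (by rw [← hb]; simp)
  have ht0 : ∀ i, t i ≠ 0 := fun i h => one_ne_zero <| ht.symm.trans <|
    Finset.prod_eq_zero (Finset.mem_univ i) h
  have hb1 : ‖b ^ (n + 1)‖ < 1 := by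
    rw [norm_pow]
    refine pow_lt_one₀ (norm_nonneg _) ?_ n.succ_ne_zero
    rw [← hb, norm_pow] at ha
    exact (pow_lt_one_iff_of_nonneg (norm_nonneg _) two_ne_zero).1 ha
  have hA : ∀ (k : ℤ) i, b * x ^ (1 + k.natAbs) * (t i)⁻¹ ≠ 0 := fun k i =>
    mul_ne_zero (mul_ne_zero hb0 (pow_ne_zero _ hx0)) (inv_ne_zero (ht0 i))
  have hB : ∀ (k : ℤ) i, b⁻¹ * x ^ (1 + k.natAbs) * t i ≠ 0 := fun k i =>
    mul_ne_zero (mul_ne_zero (inv_ne_zero hb0) (pow_ne_zero _ hx0)) (ht0 i)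
  have hB1 : ∀ (k : ℤ) i, ‖b⁻¹ * x ^ (1 + k.natAbs) * t i‖ < 1 := by
    intro k i
    -- Squaring removes the square roots and exposes the hypothesis `|q tᵢ²| < |a|`.
    have h1 : (b⁻¹ * x ^ (1 + k.natAbs) * t i) ^ 2 = q * t i ^ 2 / a * q ^ k.natAbs := by
      rw [← hx, ← hb]; field_simp; ring
    refine (pow_lt_one_iff_of_nonneg (norm_nonneg _) two_ne_zero).1 ?_
    rw [← norm_pow, h1, norm_mul, norm_pow, norm_div]
    exact mul_lt_one_of_nonneg_of_lt_one_left (by positivity)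
      ((div_lt_one (norm_pos_iff.2 ha0)).2 (hqa i)) (pow_le_one₀ (norm_nonneg _) hq1.le)
  have hκ : ∀ k : ℤ, ‖∏ i, (b * x ^ (1 + k.natAbs) * (t i)⁻¹) /
      (b⁻¹ * x ^ (1 + k.natAbs) * t i)‖ < 1 := by
    intro k
    have h1 : ∀ i, (b * x ^ (1 + k.natAbs) * (t i)⁻¹) / (b⁻¹ * x ^ (1 + k.natAbs) * t i) =
        a * ((t i)⁻¹ * (t i)⁻¹) := fun i => by
      rw [← hb]
      have := ht0 i
      field_simp
    simp_rw [h1, Finset.prod_mul_distrib, Finset.prod_inv_distrib, ht]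
    simpa using pow_lt_one₀ (norm_nonneg _) ha n.succ_ne_zero
  have hgen' : ∀ k : ℤ, ∀ i j, i ≠ j → ∀ e : ℤ, b⁻¹ * x ^ (1 + k.natAbs) * t i ≠
      q ^ e * (b⁻¹ * x ^ (1 + k.natAbs) * t j) := by
    intro k i j hij e h
    refine hgen i j hij e (mul_left_cancel₀
      (mul_ne_zero (inv_ne_zero hb0) (pow_ne_zero (1 + k.natAbs) hx0)) ?_)
    rw [h]; ring
  have hint : ∀ k z, electricIntegrand x b t k z =
      qPochRatio (fun i => b * x ^ (1 + k.natAbs) * (t i)⁻¹)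
        (fun i => b⁻¹ * x ^ (1 + k.natAbs) * t i) q z := fun k z => by rw [← hx]; rfl
  set φ : Fin (n + 1) → ℕ → ℂ := fun j =>
    basicHypTerm (numParam q a t j) (denParam q t j) q (b ^ (n + 1))
  have hφs : ∀ j, Summable (φ j) := fun j =>
    summable_basicHypTerm _ hq1 hb1 (denParam_mul_pow_ne_one ht0 hgen j)
  have hsum : ∀ j, HasSum (fun p : ℤ × ℕ => prodPrefactor q a t j *
      (φ j (p.1.natAbs + p.2) * φ j p.2)) (prodPrefactor q a t j * (∑' m, φ j m) ^ 2) := fun j =>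
    (hasSum_natAbs_add_mul (hφs j)).mul_left _
  have hrow : ∀ (k : ℤ) j, Summable fun m => prodPrefactor q a t j *
      (φ j (k.natAbs + m) * φ j m) := fun k j => (hsum j).summable.prod_factor k
  have hterm : ∀ k : ℤ, electricTerm x b t k =
      ∑ j, ∑' m, prodPrefactor q a t j * (φ j (k.natAbs + m) * φ j m) := by
    intro k
    set A : Fin (n + 1) → ℂ := fun i => b * x ^ (1 + k.natAbs) * (t i)⁻¹
    set B : Fin (n + 1) → ℂ := fun i => b⁻¹ * x ^ (1 + k.natAbs) * t i
    have hres : ∀ j m, b ^ ((n + 1) * k.natAbs) * qPochRatioResidue A B q j m =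
        prodPrefactor q a t j * (φ j (k.natAbs + m) * φ j m) := fun j m =>
      pow_mul_qPochRatioResidue hx hb hq0 hq1 ha0 ht0 ht hqa hgen k.natAbs j m
    have hbk : b ^ ((n + 1) * k.natAbs) ≠ 0 := pow_ne_zero _ hb0
    -- Summability of the residues is read off from a row of the double series, after scaling by a
    -- nonzero power of `b`.
    have hs : Summable fun p : Fin (n + 1) × ℕ => qPochRatioResidue A B q p.1 p.2 := by
      refine (summable_mul_left_iff hbk).1 ?_
      simp only [hres]
      exact summable_prod_of_finite (hrow k)
    simp only [electricTerm, hint]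
    rw [circleIntegral_qPochRatio_eq_tsum (A := A) (B := B) hq0 hq1 (hA k) (hB k) (hB1 k) (hκ k)
      (hgen' k) hs, ← tsum_mul_left]
    simp only [hres]
    rw [(summable_prod_of_finite (hrow k)).tsum_prod, tsum_fintype]
  -- Each flux contribution is a finite sum over `j` of row sums, so summing the rows of each double
  -- series gives the total.
  have hall : HasSum (electricTerm x b t) (∑ j, prodPrefactor q a t j * (∑' m, φ j m) ^ 2) := by
    rw [funext hterm]
    exact hasSum_sum fun j _ => (hsum j).prod_fiberwise fun k => (hrow k j).hasSum
  refine ⟨fun k => ?_, hall.summable, hφs, hall.tsum_eq⟩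
  simp only [hint]
  exact circleIntegrable_qPochRatio hq1 (hB1 k)
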